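/- **Setting.** There are $M\ge 1$ clients, $K\ge 2$ arms and $T$ rounds. In round $t$ an undirected graph $G_t$ on the clients is given. Client $m$ pulls an arm $a_m^t$ and obtains the reward $r^m_{a_m^t}(t)$. Then the clients exchange information with their neighbours in $G_t$: each client passes on its own record of the round (its neighbours, its arm, its reward) and all records received before. The rewards $r_i^m(t)\in[0,1]$ are independent over clients and arms and i.i.d. over the rounds, with means $\mu_i^m$ that may differ between clients; put $\mu_i=\frac1M\sum_m\mu_i^m$. An algorithm is any (possibly randomized, possibly horizon-dependent) bandit-feedback rule by which each client chooses its arm from its current neighbours and the records received in earlier rounds. The graphs, the rewards and the algorithm's internal randomness are independent. The (expected) regret is $$R_T^\pi=\mathbb E\Big[T\max_i\mu_i-\frac1M\sum_{t=1}^T\sum_{m=1}^M\mu^m_{a_m^t}\Big].$$ **Graph families.** Either (i) $(G_t)$ is a deterministic sequence, stationary or temporal, in which every $G_t$ is complete, connected or regular; or (ii) $(G_t)$ follows the Erdős–Rényi model, i.e. for some $c\in[0,1]$ each $G_t$ contains every edge independently with probability $c$ (with any joint law over the rounds); or (iii) the $G_t$ are random connected graphs, i.e. random graphs that are almost surely connected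 (with any joint law). **Theorem.** There is a universal constant $c>0$ such that for all $M\ge1$, $K\ge2$, $T$, for every law of $(G_t)$ in these families (in particular for complete graphs) and for every algorithm $\pi$ there is a problem instance with $$R_T^\pi\ \ge\ c\,\min\Big\{T,\ \sqrt{\tfrac{KT}{1+M}}\Big\}.$$ Consequently the mean-gap-independent regret of any algorithm is $\Omega(\sqrt T)$: for every $M\ge1$ there is $c_M>0$ such that for all $K\ge2$, all $T$, every law of $(G_t)$ in these families and every algorithm $\pi$ there is a problem instance with $R_T^\pi\ge c_M\sqrt T$. -/

import Mathlib

open MeasureTheory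

noncomputable section

namespace MultiAgentBandit

/-- A stochastic problem instance with `M` clients and `K` arms: the reward of arm `i` at client
`m` has law `law m i`, a probability measure carried by `[0, 1]`. The laws may differ from client
to client. -/
structure Instance (M K : ℕ) where
  law : Fin M → Fin K → Measure ℝ
  isProb : ∀ m i, IsProbabilityMeasure (law m i)
  bounded : ∀ m i, ∀ᵐ x ∂(law m i), x ∈ Set.Icc (0 : ℝ) 1

/-- The mean reward `μ_i^m` of arm `i` at client `m`. -/
def Instance.mean {M K : ℕ} (ν : Instance M K) (m : Fin M) (i : Fin K) : ℝ :=
  ∫ x, x ∂(ν.law m i)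

/-- The global mean `μ_i`, the average over the clients of the mean rewards of arm `i`. -/
def Instance.globalMean {M K : ℕ} (ν : Instance M K) (i : Fin K) : ℝ :=
  (1 / (M : ℝ)) * ∑ m, ν.mean m i

/-- The law of the table of all rewards `r t m i` (round `t`, client `m`, arm `i`): the rewards
are independent, and identically distributed over the rounds. -/
def Instance.rewardLaw {M K : ℕ} (ν : Instance M K) (T : ℕ) :
    Measure (Fin T → Fin M → Fin K → ℝ) :=
  Measure.pi fun _ => Measure.pi fun m => Measure.pi fun i => ν.law m i

/-- `Received G t m s j`: client `m` has, after the communication phase of round `t`, the record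
that client `j` made in round `s`. In every round each client passes on to its current neighbours
its record of that round and all records that it had received before. -/
inductive Received {M T : ℕ} (G : Fin T → SimpleGraph (Fin M)) :
    Fin T → Fin M → Fin T → Fin M → Prop
  | fresh (t : Fin T) (m j : Fin M) (h : j = m ∨ (G t).Adj m j) : Received G t m t j
  | relay (t t' : Fin T) (m k : Fin M) (s : Fin T) (j : Fin M) (ht : (t : ℕ) + 1 = (t' : ℕ))
      (h : k = m ∨ (G t').Adj m k) (hk : Received G t k s j) : Received G t' m s j

/-- The records (indexed by round and client) available to client `m` when it chooses its arm in
round `t`: those received by the end of the preceding round. -/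
def known {M T : ℕ} (G : Fin T → SimpleGraph (Fin M)) (t : Fin T) (m : Fin M) :
    Set (Fin T × Fin M) :=
  {p | ∃ u : Fin T, (u : ℕ) + 1 = (t : ℕ) ∧ Received G u m p.1 p.2}

theorem Received.le {M T : ℕ} {G : Fin T → SimpleGraph (Fin M)} {t : Fin T} {m : Fin M}
    {s : Fin T} {j : Fin M} (h : Received G t m s j) : (s : ℕ) ≤ (t : ℕ) := by
  induction h with
  | fresh => exact le_rfl
  | relay t t' m k s j ht h hk ih => omega

theorem lt_of_mem_known {M T : ℕ} {G : Fin T → SimpleGraph (Fin M)} {t : Fin T} {m : Fin M}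
    {p : Fin T × Fin M} (h : p ∈ known G t m) : (p.1 : ℕ) < (t : ℕ) := by
  obtain ⟨u, hu, hr⟩ := h
  have := hr.le
  omega

/-- The record a client makes in a round: its neighbours, the arm it pulled, and the reward that
it obtained from that arm. -/
abbrev Record (M K : ℕ) : Type := Set (Fin M) × Fin K × ℝ

/-- A (possibly randomized) algorithm with bandit feedback. In round `t`, client `m` chooses its
arm as a measurable function of the random seed, of its current neighbours, and of the records
available to it. The seed space `S` is arbitrary, so the clients may have private as well as
common randomness. -/
structure Policy (M K T : ℕ) (S : Type*) [MeasurableSpace S] where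
  choose : Fin T → Fin M → Set (Fin M) → (D : Set (Fin T × Fin M)) → S → (D → Record M K) → Fin K
  measurable_choose : ∀ (t : Fin T) (m : Fin M) (N : Set (Fin M)) (D : Set (Fin T × Fin M)),
    Measurable fun x : S × (D → Record M K) => choose t m N D x.1 x.2

/-- The arm `a_m^t` that client `m` pulls in round `t`, for the graph sequence `G`, the seed `s`
and the reward table `r`. -/
def Policy.action {M K T : ℕ} {S : Type*} [MeasurableSpace S] (π : Policy M K T S)
    (G : Fin T → SimpleGraph (Fin M)) (s : S) (r : Fin T → Fin M → Fin K → ℝ)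
    (t : Fin T) (m : Fin M) : Fin K :=
  π.choose t m ((G t).neighborSet m) (known G t m) s fun p =>
    ((G p.1.1).neighborSet p.1.2,
      Policy.action π G s r p.1.1 p.1.2,
      r p.1.1 p.1.2 (Policy.action π G s r p.1.1 p.1.2))
termination_by (t : ℕ)
decreasing_by all_goals exact lt_of_mem_known p.2

/-- The regret `T μ_{i*} - (1/M) ∑_t ∑_m μ_{a_m^t}^m` of an array of actions. -/
def regret {M K T : ℕ} (ν : Instance M K) (a : Fin T → Fin M → Fin K) : ℝ :=
  (T : ℝ) * (⨆ i, ν.globalMean i) - (1 / (M : ℝ)) * ∑ t, ∑ m, ν.mean m (a t m)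

/-- The expected regret of the algorithm `π` with seed law `ρ` on the instance `ν`, when the graph
sequence has law `Q`; graphs, seed and rewards are independent. -/
def expectedRegret {M K T : ℕ} {S : Type*} [MeasurableSpace S] (ν : Instance M K)
    (Q : Measure (Fin T → SimpleGraph (Fin M))) (ρ : Measure S) (π : Policy M K T S) : ℝ :=
  ∫ ω, regret ν (π.action ω.1.1 ω.1.2 ω.2) ∂((Q.prod ρ).prod (ν.rewardLaw T))

/-- All vertices have the same degree. -/
def IsRegular {M : ℕ} (G : SimpleGraph (Fin M)) : Prop :=
  ∃ d : ℕ, ∀ v, (G.neighborSet v).ncard = d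

/-- A deterministic graph sequence, stationary or temporal, all of whose members are complete,
connected or regular. -/
def IsDeterministicModel {M T : ℕ} (Q : Measure (Fin T → SimpleGraph (Fin M))) : Prop :=
  ∃ G : Fin T → SimpleGraph (Fin M),
    (∀ t, G t = ⊤ ∨ (G t).Connected ∨ IsRegular (G t)) ∧ Q = Measure.dirac G

/-- The Erdős–Rényi model: every `G_t` contains each edge independently with probability `c`.
The joint law over the rounds is arbitrary. -/
def IsErdosRenyiModel {M T : ℕ} (Q : Measure (Fin T → SimpleGraph (Fin M))) : Prop :=
  ∃ c : unitInterval, ∀ t, Q.map (fun G => G t) = SimpleGraph.binomialRandom (Fin M) c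

/-- Random connected graphs: every `G_t` is almost surely connected. -/
def IsRandomConnectedModel {M T : ℕ} (Q : Measure (Fin T → SimpleGraph (Fin M))) : Prop :=
  ∀ᵐ G ∂Q, ∀ t, (G t).Connected

end MultiAgentBandit

end

/-!
The lower bound holds for every law of the graphs, because the hard instances are already hard for
clients that share all their records: only the fact that an action is determined by the rewards
obtained in earlier rounds is used (`Policy.action_congr`), and the graphs are treated, like the
seed, as exogenous randomness.

All clients are given the same laws, so the `M` clients play a single bandit problem with `T M`
pulls. In the instance with index `J`, arm `J` has Bernoulli rewards of mean `(1 + ε) / 2` and the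
other arms have mean `1 / 2`; the regret is then `ε / (2 M)` times the number of pulls of arms
other than `J` (`regret_biased`). Given graphs and seed, the algorithm is a deterministic function
of a Boolean reward table, and the law of the table is a density times the uniform law. Entries
which are not pulled can be dropped from the density: flipping such an entry changes no action
(`expect_prod_mul_eq`). The divergence of the remaining density from the uniform law is at most
`ε²` times the expected number of pulls of arm `J` under the uniform law, so a Pinsker-type
inequality (`expect_mul_le_of_expect_eq_one`) bounds the expected number of pulls of arm `J` in
instance `J`, and summing over `J` gives `sum_expect_prod_mul_pulls_le`. With `ε` of order
`min 1 √(K / (T M))` the biased arm is pulled at most a fixed fraction of the time on average over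
`J`, and averaging over graphs and seeds as well yields one bad `J` for the whole algorithm.
-/

open scoped BigOperators

noncomputable section

namespace MultiAgentBandit

/-! ### A Hellinger-type change of measure -/

/-- If `L` is a density with respect to the uniform law, then replacing the uniform law by `L`
changes the mean of a statistic with values in `[0, B]` by at most `2 B √D`, where `D` is the
Kullback–Leibler divergence of the uniform law relative to `L`. This is Pinsker's inequality up to
the constant; Cauchy–Schwarz applied to `L - 1 = (√L - 1) (√L + 1)` reduces it to
`log √L ≤ √L - 1`. -/
lemma expect_mul_le_of_expect_eq_one {Ω : Type*} [Fintype Ω] [Nonempty Ω] {L F : Ω → ℝ} {B : ℝ}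
    (hL : ∀ b, 0 < L b) (hL1 : 𝔼 b, L b = 1) (hF0 : ∀ b, 0 ≤ F b) (hFB : ∀ b, F b ≤ B) :
    𝔼 b, L b * F b ≤ 𝔼 b, F b + 2 * B * √(𝔼 b, -Real.log (L b)) := by
  have hB : 0 ≤ B := (hF0 (Classical.arbitrary Ω)).trans (hFB _)
  have h1 : 𝔼 b, (√(L b) - 1) ^ 2 ≤ 𝔼 b, -Real.log (L b) := by
    have h : 𝔼 b, (√(L b) - 1) ^ 2 ≤ 𝔼 b, (L b - 1 + -Real.log (L b)) := by
      refine Finset.expect_le_expect fun b _ => ?_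
      have h2 := Real.log_le_sub_one_of_pos (Real.sqrt_pos.2 (hL b))
      rw [Real.log_sqrt (hL b).le] at h2
      nlinarith [Real.sq_sqrt (hL b).le]
    rw [Finset.expect_add_distrib, Finset.expect_sub_distrib, hL1, Fintype.expect_const] at h
    linarith
  have h2 : 𝔼 b, (√(L b) + 1) ^ 2 ≤ 4 := by
    have h : 𝔼 b, (√(L b) + 1) ^ 2 ≤ 𝔼 b, (2 * L b + 2) := by
      refine Finset.expect_le_expect fun b _ => ?_
      nlinarith [Real.sq_sqrt (hL b).le, sq_nonneg (√(L b) - 1)]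
    rw [Finset.expect_add_distrib, ← Finset.mul_expect, hL1, Fintype.expect_const] at h
    linarith
  have h3 : 𝔼 b, |√(L b) - 1| * (√(L b) + 1) ≤ 2 * √(𝔼 b, -Real.log (L b)) := by
    have hcs := Finset.expect_mul_sq_le_sq_mul_sq Finset.univ (fun b => |√(L b) - 1|)
      (fun b => √(L b) + 1)
    simp only [sq_abs] at hcs
    have h0 : 0 ≤ 𝔼 b, (√(L b) - 1) ^ 2 := Finset.expect_nonneg fun b _ => sq_nonneg _
    refine (Real.le_sqrt_of_sq_le (y := 𝔼 b, -Real.log (L b) * 4) ?_).trans_eq ?_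
    · rw [← Finset.expect_mul]
      exact hcs.trans (mul_le_mul h1 h2 (Finset.expect_nonneg fun b _ => sq_nonneg _)
        (h0.trans h1))
    · rw [← Finset.expect_mul, Real.sqrt_mul (h0.trans h1), show (4 : ℝ) = 2 ^ 2 by norm_num,
        Real.sqrt_sq (by norm_num), mul_comm]
  have h4 : 𝔼 b, L b * F b ≤ 𝔼 b, (F b + B * (|√(L b) - 1| * (√(L b) + 1))) := by
    refine Finset.expect_le_expect fun b _ => ?_
    have h5 : L b - 1 ≤ |√(L b) - 1| * (√(L b) + 1) := by
      have := le_abs_self (√(L b) - 1)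
      nlinarith [Real.sq_sqrt (hL b).le, Real.sqrt_nonneg (L b)]
    have h6 : 0 ≤ |√(L b) - 1| * (√(L b) + 1) := by positivity
    nlinarith [mul_le_mul_of_nonneg_left h5 (hF0 b), mul_le_mul_of_nonneg_right (hFB b) h6]
  rw [Finset.expect_add_distrib, ← Finset.mul_expect] at h4
  nlinarith [mul_le_mul_of_nonneg_left h3 hB]

/-! ### Boolean reward tables -/

section Pulls

variable {τ κ ι : Type*} [DecidableEq ι] [Fintype τ] [Fintype κ]

/-- The number of pulls of arm `J`. -/
def pulls (a : (τ → κ → ι → Bool) → τ → κ → ι) (J : ι) (b : τ → κ → ι → Bool) : ℝ :=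
  ∑ c : τ × κ, if a b c.1 c.2 = J then 1 else 0

lemma pulls_nonneg (a : (τ → κ → ι → Bool) → τ → κ → ι) (J : ι) (b : τ → κ → ι → Bool) :
    0 ≤ pulls a J b := Finset.sum_nonneg fun c _ => by split_ifs <;> norm_num

lemma pulls_le (a : (τ → κ → ι → Bool) → τ → κ → ι) (J : ι) (b : τ → κ → ι → Bool) :
    pulls a J b ≤ Fintype.card (τ × κ) := by
  refine (Finset.sum_le_sum (g := fun _ => (1 : ℝ)) fun c _ => ?_).trans_eq (by simp)
  split_ifs <;> norm_num

lemma sum_pulls [Fintype ι] (a : (τ → κ → ι → Bool) → τ → κ → ι) (b : τ → κ → ι → Bool) :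
    ∑ J, pulls a J b = Fintype.card (τ × κ) := by
  simp only [pulls]
  rw [Finset.sum_comm]
  simp

end Pulls

section Table

variable {τ κ ι : Type*} [DecidableEq τ] [DecidableEq κ] [DecidableEq ι]

/-- The sign `±1` of a bit. -/
def bitSign (x : Bool) : ℝ := if x then 1 else -1

lemma bitSign_not (x : Bool) : bitSign (!x) = -bitSign x := by cases x <;> simp [bitSign]

lemma abs_bitSign (x : Bool) : |bitSign x| = 1 := by cases x <;> simp [bitSign]

/-- The table obtained from `b` by flipping the entry of arm `i` in the cell `c` (a round and a
client). -/
def flipAt (c : τ × κ) (i : ι) (b : τ → κ → ι → Bool) : τ → κ → ι → Bool :=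
  fun t m j => if t = c.1 ∧ m = c.2 ∧ j = i then !b t m j else b t m j

lemma flipAt_flipAt (c : τ × κ) (i : ι) (b : τ → κ → ι → Bool) :
    flipAt c i (flipAt c i b) = b := by
  funext t m j
  simp only [flipAt]
  split_ifs <;> simp

lemma flipAt_self (c : τ × κ) (i : ι) (b : τ → κ → ι → Bool) :
    flipAt c i b c.1 c.2 i = !b c.1 c.2 i := by simp [flipAt]

lemma flipAt_of_ne {c c' : τ × κ} (i j : ι) (b : τ → κ → ι → Bool) (h : c' ≠ c) :
    flipAt c i b c'.1 c'.2 j = b c'.1 c'.2 j := by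
  have : ¬ (c'.1 = c.1 ∧ c'.2 = c.2 ∧ j = i) := fun h' => h (Prod.ext h'.1 h'.2.1)
  simp only [flipAt, if_neg this]

variable [Fintype τ] [Fintype κ] [Fintype ι]

lemma expect_flipAt (c : τ × κ) (i : ι) (f : (τ → κ → ι → Bool) → ℝ) :
    𝔼 b, f (flipAt c i b) = 𝔼 b, f b :=
  Fintype.expect_equiv (Function.Involutive.toPerm (flipAt c i) (flipAt_flipAt c i)) _ _
    fun _ => rfl

lemma expect_eq_zero_of_flipAt (c : τ × κ) (i : ι) {f : (τ → κ → ι → Bool) → ℝ}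
    (h : ∀ b, f (flipAt c i b) = -f b) : 𝔼 b, f b = 0 := by
  have h1 := expect_flipAt c i f
  simp only [h, Finset.expect_neg_distrib] at h1
  linarith

/-- The factors `1 + ε s` of the likelihood ratio of the cells in which arm `J` is not observed
have conditional mean `1` given the observations, so they can be dropped. Here `p b c` says that
the entry of arm `J` in cell `c` is observed; flipping an unobserved entry changes neither what is
observed nor the statistic `F`. -/
lemma expect_prod_mul_eq (J : ι) (ε : ℝ) (p : (τ → κ → ι → Bool) → τ × κ → Prop)
    [∀ b c, Decidable (p b c)]
    (F : (τ → κ → ι → Bool) → ℝ) (hp : ∀ b c c', ¬ p b c → (p (flipAt c J b) c' ↔ p b c'))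
    (hF : ∀ b c, ¬ p b c → F (flipAt c J b) = F b) :
    𝔼 b, (∏ c : τ × κ, (1 + ε * bitSign (b c.1 c.2 J))) * F b =
      𝔼 b, (∏ c : τ × κ, if p b c then 1 + ε * bitSign (b c.1 c.2 J) else 1) * F b := by
  -- The factors are inserted one cell at a time; each insertion adds a term that is odd under the
  -- flip of arm `J` in that cell.
  have key : ∀ S : Finset (τ × κ),
      𝔼 b, (∏ c : τ × κ, if c ∈ S ∨ p b c then 1 + ε * bitSign (b c.1 c.2 J) else 1) * F b =
        𝔼 b, (∏ c : τ × κ, if p b c then 1 + ε * bitSign (b c.1 c.2 J) else 1) * F b := by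
    intro S
    induction S using Finset.induction_on with
    | empty => simp
    | insert c S hc ih =>
      rw [← ih, ← sub_eq_zero, ← Finset.expect_sub_distrib]
      have hf : ∀ b, (∏ c' : τ × κ, if c' ∈ insert c S ∨ p b c' then
            1 + ε * bitSign (b c'.1 c'.2 J) else 1) * F b
          - (∏ c' : τ × κ, if c' ∈ S ∨ p b c' then
            1 + ε * bitSign (b c'.1 c'.2 J) else 1) * F b =
          if p b c then 0 else ε * bitSign (b c.1 c.2 J) *
            ((∏ c' ∈ Finset.univ.erase c, if c' ∈ S ∨ p b c' then
              1 + ε * bitSign (b c'.1 c'.2 J) else 1) * F b) := by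
        intro b
        rw [← Finset.mul_prod_erase _ _ (Finset.mem_univ c),
          ← Finset.mul_prod_erase Finset.univ (fun c' : τ × κ => if c' ∈ S ∨ p b c' then
            1 + ε * bitSign (b c'.1 c'.2 J) else 1) (Finset.mem_univ c)]
        have h1 : ∏ c' ∈ Finset.univ.erase c, (if c' ∈ insert c S ∨ p b c' then
              1 + ε * bitSign (b c'.1 c'.2 J) else 1) =
            ∏ c' ∈ Finset.univ.erase c, (if c' ∈ S ∨ p b c' then
              1 + ε * bitSign (b c'.1 c'.2 J) else 1) := by
          refine Finset.prod_congr rfl fun c' hc' => ?_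
          simp [Finset.ne_of_mem_erase hc']
        rw [h1]
        by_cases hpc : p b c
        · simp [hpc]
        · simp only [Finset.mem_insert_self, true_or, if_true, hc, hpc, or_self, if_false]
          ring
      simp only [hf]
      refine expect_eq_zero_of_flipAt c J fun b => ?_
      by_cases hpc : p b c
      · have hpc' : p (flipAt c J b) c := by
          by_contra h
          have h2 := hp _ _ c h
          rw [flipAt_flipAt] at h2
          exact h (h2.1 hpc)
        simp [hpc, hpc']
      · simp only [hp b c _ hpc, hF b c hpc, flipAt_self, bitSign_not, if_neg hpc]
        have h1 : ∏ c' ∈ Finset.univ.erase c, (if c' ∈ S ∨ p b c' then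
              1 + ε * bitSign (flipAt c J b c'.1 c'.2 J) else 1) =
            ∏ c' ∈ Finset.univ.erase c, (if c' ∈ S ∨ p b c' then
              1 + ε * bitSign (b c'.1 c'.2 J) else 1) := by
          refine Finset.prod_congr rfl fun c' hc' => ?_
          rw [flipAt_of_ne _ _ _ (Finset.ne_of_mem_erase hc')]
        rw [h1]
        ring
  rw [← key Finset.univ]
  simp

lemma expect_prod_eq_one (J : ι) (ε : ℝ) :
    𝔼 b : τ → κ → ι → Bool, (∏ c : τ × κ, (1 + ε * bitSign (b c.1 c.2 J))) = 1 := by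
  have h := expect_prod_mul_eq (τ := τ) (κ := κ) J ε (fun _ _ => False) (fun _ => 1)
    (fun _ _ _ _ => Iff.rfl) (fun _ _ _ => rfl)
  simpa using h

/-- In the cell `c`, whether arm `J` is pulled does not depend on its entry there, so the expected
log-likelihood of the cell is `½ log (1 - ε²)` times the probability of the pull. -/
lemma expect_ite_log_eq (J : ι) {ε : ℝ} (hε : |ε| < 1) (c : τ × κ)
    (p : (τ → κ → ι → Bool) → Prop) [DecidablePred p] (hp : ∀ b, p (flipAt c J b) ↔ p b) :
    𝔼 b, (if p b then Real.log (1 + ε * bitSign (b c.1 c.2 J)) else 0) =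
      Real.log (1 - ε ^ 2) / 2 * 𝔼 b, (if p b then (1 : ℝ) else 0) := by
  obtain ⟨h1, h2⟩ := abs_lt.1 hε
  have hlog : ∀ x : Bool, Real.log (1 + ε * bitSign x) + Real.log (1 + ε * bitSign (!x)) =
      Real.log (1 - ε ^ 2) := by
    have : Real.log (1 - ε ^ 2) = Real.log (1 + ε) + Real.log (1 - ε) := by
      rw [← Real.log_mul (by linarith) (by linarith)]
      ring_nf
    intro x
    cases x <;> simp only [bitSign, this, Bool.not_true, Bool.not_false, if_true,
      Bool.false_eq_true, if_false] <;> ring_nf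
  have hsum : 𝔼 b, (if p b then Real.log (1 + ε * bitSign (b c.1 c.2 J)) else 0) +
      𝔼 b, (if p b then Real.log (1 + ε * bitSign (b c.1 c.2 J)) else 0) =
      Real.log (1 - ε ^ 2) * 𝔼 b, (if p b then (1 : ℝ) else 0) := by
    nth_rewrite 2 [← expect_flipAt c J]
    rw [← Finset.expect_add_distrib, Finset.mul_expect]
    refine Finset.expect_congr rfl fun b _ => ?_
    simp only [hp, flipAt_self]
    split_ifs
    · rw [hlog, mul_one]
    · simp
  linarith

lemma neg_log_one_sub_sq_le {ε : ℝ} (h0 : 0 ≤ ε) (h : ε ≤ 1 / 2) :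
    -(Real.log (1 - ε ^ 2) / 2) ≤ ε ^ 2 := by
  have h1 : 0 < 1 - ε ^ 2 := by nlinarith
  have h2 := Real.one_sub_inv_le_log_of_pos h1
  have h3 : (1 - ε ^ 2)⁻¹ ≤ 1 + 2 * ε ^ 2 := by
    rw [inv_le_iff_one_le_mul₀ h1]
    nlinarith [sq_nonneg ε, mul_nonneg (sq_nonneg ε) (show 0 ≤ 1 - 2 * ε ^ 2 by nlinarith)]
  linarith

/-- The bias of arm `J` raises the expected number of its pulls by at most a multiple of
`ε √(expected pulls under the uniform law)`. The assumptions `h1` and `h2` say that `a` is a bandit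
algorithm: changing an entry that is not pulled does not change any action, and an action does not
depend on the rewards of its own cell. -/
lemma expect_prod_mul_pulls_le (a : (τ → κ → ι → Bool) → τ → κ → ι) (J : ι) {ε : ℝ}
    (hε0 : 0 ≤ ε) (hε : ε ≤ 1 / 2)
    (h1 : ∀ b (c : τ × κ) i, a b c.1 c.2 ≠ i → a (flipAt c i b) = a b)
    (h2 : ∀ b (c : τ × κ) i, a (flipAt c i b) c.1 c.2 = a b c.1 c.2) :
    𝔼 b, (∏ c : τ × κ, (1 + ε * bitSign (b c.1 c.2 J))) * pulls a J b ≤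
      𝔼 b, pulls a J b + 2 * Fintype.card (τ × κ) * (ε * √(𝔼 b, pulls a J b)) := by
  have hpos : ∀ x : Bool, 0 < 1 + ε * bitSign x := by
    intro x
    have := neg_abs_le (bitSign x)
    rw [abs_bitSign] at this
    nlinarith
  have hp : ∀ (b : τ → κ → ι → Bool) (c c' : τ × κ), ¬ a b c.1 c.2 = J →
      (a (flipAt c J b) c'.1 c'.2 = J ↔ a b c'.1 c'.2 = J) := by
    intro b c c' hc
    rw [h1 b c J hc]
  set L : (τ → κ → ι → Bool) → ℝ := fun b =>
    ∏ c : τ × κ, if a b c.1 c.2 = J then 1 + ε * bitSign (b c.1 c.2 J) else 1 with hL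
  have hL0 : ∀ b, 0 < L b := fun b => Finset.prod_pos fun c _ => by
    split_ifs
    exacts [hpos _, one_pos]
  have hL1 : 𝔼 b, L b = 1 := by
    have h := expect_prod_mul_eq J ε (fun b c => a b c.1 c.2 = J) (fun _ => 1) hp
      (fun _ _ _ => rfl)
    simp only [mul_one] at h
    rw [← expect_prod_eq_one (τ := τ) (κ := κ) J ε, h]
  have hKL : 𝔼 b, -Real.log (L b) = -(Real.log (1 - ε ^ 2) / 2) * 𝔼 b, pulls a J b := by
    have hlog : ∀ b, Real.log (L b) =
        ∑ c : τ × κ, if a b c.1 c.2 = J then Real.log (1 + ε * bitSign (b c.1 c.2 J)) else 0 := by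
      intro b
      rw [hL, Real.log_prod fun c _ => by split_ifs; exacts [(hpos _).ne', one_ne_zero]]
      refine Finset.sum_congr rfl fun c _ => ?_
      split_ifs <;> simp
    simp only [pulls, Finset.expect_neg_distrib, hlog, Finset.expect_sum_comm]
    rw [neg_mul, Finset.mul_sum]
    refine congrArg _ (Finset.sum_congr rfl fun c _ => ?_)
    exact expect_ite_log_eq J (abs_lt.2 ⟨by linarith, by linarith⟩) c _
      fun b => by rw [h2]
  rw [expect_prod_mul_eq J ε (fun b c => a b c.1 c.2 = J) _ hp
    (fun b c hc => by simp only [pulls, h1 b c J hc])]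
  refine (expect_mul_le_of_expect_eq_one hL0 hL1 (pulls_nonneg a J) (pulls_le a J)).trans ?_
  have hn : 0 ≤ 𝔼 b, pulls a J b := Finset.expect_nonneg fun b _ => pulls_nonneg a J b
  gcongr
  rw [hKL]
  calc √(-(Real.log (1 - ε ^ 2) / 2) * 𝔼 b, pulls a J b)
      ≤ √(ε ^ 2 * 𝔼 b, pulls a J b) := by gcongr; exact neg_log_one_sub_sq_le hε0 hε
    _ = ε * √(𝔼 b, pulls a J b) := by rw [Real.sqrt_mul (sq_nonneg _), Real.sqrt_sq hε0]

/-- Summing over the arms, Cauchy–Schwarz bounds the sum of the square roots, since the pulls of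
all arms add up to the number of cells. -/
lemma sum_expect_prod_mul_pulls_le (a : (τ → κ → ι → Bool) → τ → κ → ι) {ε : ℝ}
    (hε0 : 0 ≤ ε) (hε : ε ≤ 1 / 2)
    (h1 : ∀ b (c : τ × κ) i, a b c.1 c.2 ≠ i → a (flipAt c i b) = a b)
    (h2 : ∀ b (c : τ × κ) i, a (flipAt c i b) c.1 c.2 = a b c.1 c.2) :
    ∑ J, 𝔼 b, (∏ c : τ × κ, (1 + ε * bitSign (b c.1 c.2 J))) * pulls a J b ≤
      Fintype.card (τ × κ) + 2 * Fintype.card (τ × κ) *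
        (ε * √(Fintype.card ι * Fintype.card (τ × κ))) := by
  have hn : ∀ J, 0 ≤ 𝔼 b, pulls a J b := fun J =>
    Finset.expect_nonneg fun b _ => pulls_nonneg a J b
  have hs : ∑ J, 𝔼 b, pulls a J b = Fintype.card (τ × κ) := by
    rw [← Finset.expect_sum_comm]
    simp only [sum_pulls]
    exact Fintype.expect_const _
  have hcs : ∑ J, √(𝔼 b, pulls a J b) ≤ √(Fintype.card ι * Fintype.card (τ × κ)) := by
    refine Real.le_sqrt_of_sq_le ?_
    have := sq_sum_le_card_mul_sum_sq (s := Finset.univ) (f := fun J => √(𝔼 b, pulls a J b))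
    simpa only [Real.sq_sqrt (hn _), hs, Finset.card_univ] using this
  refine (Finset.sum_le_sum fun J _ => expect_prod_mul_pulls_le a J hε0 hε h1 h2).trans ?_
  rw [Finset.sum_add_distrib, hs, ← Finset.mul_sum, ← Finset.mul_sum]
  gcongr

end Table

/-! ### The actions of an algorithm -/

section Action

variable {M K T : ℕ} {S : Type*} [MeasurableSpace S]

/-- The action in round `t` depends on the reward table only through the rewards obtained in the
rounds before `t`. -/
lemma Policy.action_congr (π : Policy M K T S) (G : Fin T → SimpleGraph (Fin M)) (s : S)
    {r r' : Fin T → Fin M → Fin K → ℝ} (t : Fin T)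
    (h : ∀ u < t, ∀ j, r u j (π.action G s r u j) = r' u j (π.action G s r u j)) (m : Fin M) :
    π.action G s r t m = π.action G s r' t m := by
  induction t using WellFoundedLT.induction generalizing m with
  | ind t ih =>
    rw [Policy.action, Policy.action]
    congr 1
    funext p
    have hlt : p.1.1 < t := lt_of_mem_known p.2
    have ha := ih _ hlt (fun u hu => h u (hu.trans hlt)) p.1.2
    rw [← ha, h _ hlt]

lemma Policy.measurable_action (π : Policy M K T S) (G : Fin T → SimpleGraph (Fin M))
    (t : Fin T) (m : Fin M) :
    Measurable fun x : S × (Fin T → Fin M → Fin K → ℝ) => π.action G x.1 x.2 t m := by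
  induction t using WellFoundedLT.induction generalizing m with
  | ind t ih =>
    have heq : (fun x : S × (Fin T → Fin M → Fin K → ℝ) => π.action G x.1 x.2 t m) = fun x =>
        π.choose t m ((G t).neighborSet m) (known G t m) x.1 fun p =>
          ((G p.1.1).neighborSet p.1.2, π.action G x.1 x.2 p.1.1 p.1.2,
            x.2 p.1.1 p.1.2 (π.action G x.1 x.2 p.1.1 p.1.2)) := by
      funext x
      rw [Policy.action]
    rw [heq]
    refine (π.measurable_choose t m _ _).comp
      (measurable_fst.prodMk (measurable_pi_iff.2 fun p => ?_))
    have ha := ih _ (lt_of_mem_known p.2) p.1.2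
    refine measurable_const.prodMk (ha.prodMk ?_)
    have hev : Measurable fun y : Fin K × (Fin K → ℝ) => y.2 y.1 :=
      measurable_from_prod_countable_right fun i => measurable_pi_apply i
    have hrow : Measurable fun x : S × (Fin T → Fin M → Fin K → ℝ) => x.2 p.1.1 p.1.2 := by
      fun_prop
    exact hev.comp (ha.prodMk hrow)

instance {V : Type*} [Countable V] : MeasurableSingletonClass (SimpleGraph V) where
  measurableSet_singleton G := by
    have h : ({G} : Set (SimpleGraph V)) = SimpleGraph.edgeSet ⁻¹' {G.edgeSet} := by
      ext H
      simp
    rw [h]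
    exact SimpleGraph.measurable_edgeSet (measurableSet_singleton _)

/-- There are only finitely many graph sequences, so measurability for each of them suffices. -/
lemma Policy.measurable_action_prod (π : Policy M K T S) :
    Measurable fun ω : ((Fin T → SimpleGraph (Fin M)) × S) × (Fin T → Fin M → Fin K → ℝ) =>
      π.action ω.1.1 ω.1.2 ω.2 := by
  have h : Measurable fun y : (Fin T → SimpleGraph (Fin M)) ×
      (S × (Fin T → Fin M → Fin K → ℝ)) => π.action y.1 y.2.1 y.2.2 :=
    measurable_from_prod_countable_right fun G =>
      measurable_pi_iff.2 fun t => measurable_pi_iff.2 fun m => π.measurable_action G t m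
  exact h.comp (by fun_prop : Measurable fun ω : ((Fin T → SimpleGraph (Fin M)) × S) ×
    (Fin T → Fin M → Fin K → ℝ) => (ω.1.1, (ω.1.2, ω.2)))

lemma integrable_regret (ν : Instance M K) (π : Policy M K T S)
    (P : Measure (((Fin T → SimpleGraph (Fin M)) × S) × (Fin T → Fin M → Fin K → ℝ)))
    [IsFiniteMeasure P] :
    Integrable (fun ω => regret ν (π.action ω.1.1 ω.1.2 ω.2)) P := by
  have hm : Measurable (regret (T := T) ν) := measurable_of_countable _
  refine Integrable.of_bound (hm.comp π.measurable_action_prod).aestronglyMeasurable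
    (∑ a : Fin T → Fin M → Fin K, ‖regret ν a‖) (ae_of_all _ fun ω => ?_)
  exact Finset.single_le_sum (f := fun a => ‖regret ν a‖) (fun a _ => norm_nonneg _)
    (Finset.mem_univ _)

end Action

/-! ### Homogeneous Bernoulli instances -/

section Bernoulli

variable {M K : ℕ}

open ProbabilityTheory in
/-- The instance in which, at every client, the reward of arm `i` is `1` with probability `p i` and
`0` otherwise. -/
def bernoulliInstance (M : ℕ) (p : Fin K → unitInterval) : Instance M K where
  law _ i := bernoulliMeasure 1 0 (p i)
  isProb _ _ := inferInstance
  bounded _ i := by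
    rw [ae_iff]
    exact bernoulliMeasure_apply_of_notMem_of_notMem (p i) measurableSet_Icc.compl
      (by simp) (by simp)

lemma bernoulliInstance_mean (p : Fin K → unitInterval) (m : Fin M) (i : Fin K) :
    (bernoulliInstance M p).mean m i = p i := by
  simp [Instance.mean, bernoulliInstance, ProbabilityTheory.integral_bernoulliMeasure]

lemma bernoulliInstance_globalMean (hM : 1 ≤ M) (p : Fin K → unitInterval) (i : Fin K) :
    (bernoulliInstance M p).globalMean i = p i := by
  have : (M : ℝ) ≠ 0 := by positivity
  simp [Instance.globalMean, bernoulliInstance_mean, this]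

instance (ν : Instance M K) (T : ℕ) : IsProbabilityMeasure (ν.rewardLaw T) := by
  have := ν.isProb
  unfold Instance.rewardLaw
  infer_instance

/-- The real reward of a bit: `1` or `0`. -/
def bitReward (x : Bool) : ℝ := if x then 1 else 0

open ProbabilityTheory in
/-- Expectations over the rewards are finite sums over Boolean tables. -/
lemma integral_rewardLaw_bernoulliInstance (p : Fin K → unitInterval) {T : ℕ}
    {f : (Fin T → Fin M → Fin K → ℝ) → ℝ}
    (hf : AEStronglyMeasurable f ((bernoulliInstance M p).rewardLaw T)) :
    ∫ r, f r ∂(bernoulliInstance M p).rewardLaw T =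
      ∑ b : Fin T → Fin M → Fin K → Bool,
        (∏ t, ∏ m, ∏ i, if b t m i then (p i : ℝ) else 1 - p i) *
          f fun t m i => bitReward (b t m i) := by
  set μ : Measure (Fin T → Fin M → Fin K → Bool) :=
    Measure.pi fun _ => Measure.pi fun _ => Measure.pi fun i => bernoulliMeasure true false (p i)
    with hμ
  have hmap : (bernoulliInstance M p).rewardLaw T =
      μ.map fun b t m i => bitReward (b t m i) := by
    have hr : Measurable bitReward := measurable_of_countable _
    have hb : ∀ i, (bernoulliMeasure true false (p i)).map bitReward =
        bernoulliMeasure 1 0 (p i) := by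
      intro i
      rw [map_bernoulliMeasure]
      simp [bitReward]
    have h1 : (Measure.pi fun i => bernoulliMeasure true false (p i)).map
        (fun (x : Fin K → Bool) i => bitReward (x i)) =
        Measure.pi fun i => bernoulliMeasure 1 0 (p i) := by
      have (i : Fin K) : SigmaFinite ((bernoulliMeasure true false (p i)).map bitReward) := by
        rw [hb]; infer_instance
      rw [Measure.pi_map_pi fun i => hr.aemeasurable]
      simp only [hb]
    have hr1 : Measurable fun (x : Fin K → Bool) i => bitReward (x i) := measurable_of_countable _
    have h2 : (Measure.pi fun _ : Fin M => Measure.pi fun i =>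
          bernoulliMeasure true false (p i)).map
        (fun (x : Fin M → Fin K → Bool) m i => bitReward (x m i)) =
        Measure.pi fun _ : Fin M => Measure.pi fun i => bernoulliMeasure 1 0 (p i) := by
      have : SigmaFinite ((Measure.pi fun i => bernoulliMeasure true false (p i)).map
          fun (x : Fin K → Bool) i => bitReward (x i)) := by
        rw [h1]; infer_instance
      rw [Measure.pi_map_pi (f := fun _ (x : Fin K → Bool) i => bitReward (x i))
        fun _ => hr1.aemeasurable]
      simp only [h1]
    have hr2 : Measurable fun (x : Fin M → Fin K → Bool) m i => bitReward (x m i) :=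
      measurable_of_countable _
    have : SigmaFinite ((Measure.pi fun _ : Fin M => Measure.pi fun i =>
          bernoulliMeasure true false (p i)).map
        fun (x : Fin M → Fin K → Bool) m i => bitReward (x m i)) := by
      rw [h2]; infer_instance
    rw [hμ, Measure.pi_map_pi (f := fun _ (x : Fin M → Fin K → Bool) m i => bitReward (x m i))
      fun _ => hr2.aemeasurable]
    simp only [h2]
    rfl
  rw [hmap] at hf ⊢
  rw [integral_map (measurable_of_countable _).aemeasurable hf, integral_fintype .of_finite]
  refine Finset.sum_congr rfl fun b _ => ?_
  rw [smul_eq_mul]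
  congr 1
  simp only [hμ, measureReal_def, Measure.pi_singleton, ENNReal.toReal_prod]
  refine Finset.prod_congr rfl fun t _ => Finset.prod_congr rfl fun m _ =>
    Finset.prod_congr rfl fun i _ => ?_
  rw [← measureReal_def]
  cases b t m i <;> simp

end Bernoulli

/-! ### The hard instances -/

section Hard

variable {M K T : ℕ}

/-- The vector of means in which arm `J` has mean `(1 + ε) / 2` and all other arms have mean
`1 / 2`. -/
def biasedMean (ε : unitInterval) (J i : Fin K) : unitInterval :=
  ⟨(1 + if i = J then (ε : ℝ) else 0) / 2, by
    have := ε.2.1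
    have := ε.2.2
    constructor <;> split_ifs <;> linarith⟩

lemma iSup_biasedMean (ε : unitInterval) (J : Fin K) :
    ⨆ i, (biasedMean ε J i : ℝ) = (1 + ε) / 2 := by
  have := ε.2.1
  have : Nonempty (Fin K) := ⟨J⟩
  refine le_antisymm (ciSup_le fun i => ?_) ?_
  · simp only [biasedMean]
    split_ifs <;> linarith
  · refine le_ciSup_of_le (Set.finite_range _).bddAbove J ?_
    simp [biasedMean]

lemma regret_biased (hM : 1 ≤ M) (ε : unitInterval) (J : Fin K)
    (a : (Fin T → Fin M → Fin K → Bool) → Fin T → Fin M → Fin K)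
    (b : Fin T → Fin M → Fin K → Bool) :
    regret (bernoulliInstance M (biasedMean ε J)) (a b) =
      ε / (2 * M) * (T * M - pulls a J b) := by
  have hM0 : (M : ℝ) ≠ 0 := by positivity
  have hsum : ∑ t, ∑ m, (biasedMean ε J (a b t m) : ℝ) = (T * M + ε * pulls a J b) / 2 := by
    rw [← Fintype.sum_prod_type' (f := fun t m => (biasedMean ε J (a b t m) : ℝ))]
    simp only [biasedMean, pulls, ← Finset.sum_div, Finset.sum_add_distrib, Finset.mul_sum]
    simp
  simp only [regret, bernoulliInstance_globalMean hM, bernoulliInstance_mean, iSup_biasedMean,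
    hsum]
  field_simp
  ring

/-- Relative to the uniform law on Boolean tables, the law of the table with biased arm `J` has
density `∏ (1 + ε s)`, the product over the entries of arm `J` with signs `s`. -/
lemma sum_weight_mul_eq_expect (ε : unitInterval) (J : Fin K)
    (g : (Fin T → Fin M → Fin K → Bool) → ℝ) :
    ∑ b : Fin T → Fin M → Fin K → Bool,
        (∏ t, ∏ m, ∏ i, if b t m i then (biasedMean ε J i : ℝ) else 1 - biasedMean ε J i) * g b =
      𝔼 b, (∏ c : Fin T × Fin M, (1 + (ε : ℝ) * bitSign (b c.1 c.2 J))) * g b := by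
  rw [Fintype.expect_eq_sum_div_card, Finset.sum_div]
  refine Finset.sum_congr rfl fun b _ => ?_
  have h1 : ∀ t m i, (if b t m i then (biasedMean ε J i : ℝ) else 1 - biasedMean ε J i) =
      (1 / 2) * if i = J then 1 + (ε : ℝ) * bitSign (b t m i) else 1 := by
    intro t m i
    simp only [biasedMean, bitSign]
    split_ifs <;> ring
  simp only [h1, Finset.prod_mul_distrib, Finset.prod_ite_eq', Finset.mem_univ, if_true,
    Finset.prod_const, Fintype.prod_prod_type, Fintype.card_fun, Finset.card_univ,
    Fintype.card_fin, Fintype.card_bool]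
  push_cast
  simp only [one_div, inv_pow]
  ring

/-- For a fixed graph sequence and seed the algorithm is deterministic; its expected regret is
summed here over the `K` possible positions of the biased arm. -/
lemma le_sum_integral_regret {S : Type*} [MeasurableSpace S] (hM : 1 ≤ M) (hK : 2 ≤ K)
    (ε : unitInterval) (hε : (ε : ℝ) ≤ 1 / 2) (hεK : ε * √(K * (T * M)) ≤ (K : ℝ) / 8)
    (π : Policy M K T S) (G : Fin T → SimpleGraph (Fin M)) (s : S) :
    K * ((ε : ℝ) * T / 8) ≤ ∑ J : Fin K, ∫ r, regret (bernoulliInstance M (biasedMean ε J))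
      (π.action G s r) ∂(bernoulliInstance M (biasedMean ε J)).rewardLaw T := by
  set a : (Fin T → Fin M → Fin K → Bool) → Fin T → Fin M → Fin K := fun b =>
    π.action G s fun t m i => bitReward (b t m i) with ha
  have hM0 : (0 : ℝ) < M := by positivity
  have hK2 : (2 : ℝ) ≤ K := by exact_mod_cast hK
  have hact : Measurable fun r : Fin T → Fin M → Fin K → ℝ => π.action G s r :=
    measurable_pi_iff.2 fun t => measurable_pi_iff.2 fun m =>
      (π.measurable_action G t m).comp measurable_prodMk_left
  have hint : ∀ J : Fin K, ∫ r, regret (bernoulliInstance M (biasedMean ε J))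
        (π.action G s r) ∂(bernoulliInstance M (biasedMean ε J)).rewardLaw T =
      ε / (2 * M) * (T * M - 𝔼 b,
        (∏ c : Fin T × Fin M, (1 + (ε : ℝ) * bitSign (b c.1 c.2 J))) * pulls a J b) := by
    intro J
    have hm : Measurable (regret (T := T) (bernoulliInstance M (biasedMean ε J))) :=
      measurable_of_countable _
    rw [integral_rewardLaw_bernoulliInstance (f := fun r => regret _ (π.action G s r)) _
        (hm.comp hact).aestronglyMeasurable, sum_weight_mul_eq_expect]
    have hreg : ∀ b : Fin T → Fin M → Fin K → Bool,
        (∏ c : Fin T × Fin M, (1 + (ε : ℝ) * bitSign (b c.1 c.2 J))) *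
          regret (bernoulliInstance M (biasedMean ε J))
            (π.action G s fun t m i => bitReward (b t m i)) =
        ε / (2 * M) * (T * M * (∏ c : Fin T × Fin M, (1 + (ε : ℝ) * bitSign (b c.1 c.2 J))) -
          (∏ c : Fin T × Fin M, (1 + (ε : ℝ) * bitSign (b c.1 c.2 J))) * pulls a J b) := by
      intro b
      rw [show π.action G s (fun t m i => bitReward (b t m i)) = a b from rfl,
        regret_biased hM]
      ring
    simp only [hreg]
    rw [← Finset.mul_expect, Finset.expect_sub_distrib, ← Finset.mul_expect,
      expect_prod_eq_one, mul_one]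
  -- Changing an entry that is not pulled affects no action at all, and changing an entry of round
  -- `c.1` affects no action up to and including that round.
  have hflip : ∀ (b : Fin T → Fin M → Fin K → Bool) (c : Fin T × Fin M) i t m,
      (t ≤ c.1 ∨ a b c.1 c.2 ≠ i) → a (flipAt c i b) t m = a b t m := by
    intro b c i t m h
    refine (π.action_congr G s t (fun u hu j => ?_) m).symm
    change bitReward (b u j (a b u j)) = bitReward (flipAt c i b u j (a b u j))
    have : ¬ (u = c.1 ∧ j = c.2 ∧ a b u j = i) := by
      rintro ⟨rfl, rfl, h'⟩
      rcases h with h | h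
      exacts [absurd hu h.not_gt, h h']
    simp only [flipAt, if_neg this]
  have hsum := sum_expect_prod_mul_pulls_le a ε.2.1 hε
    (fun b c i h => funext fun t => funext fun m => hflip b c i t m (Or.inr h))
    (fun b c i => hflip b c i c.1 c.2 (Or.inl le_rfl))
  simp only [Fintype.card_prod, Fintype.card_fin, Nat.cast_mul] at hsum
  simp only [hint, ← Finset.mul_sum, Finset.sum_sub_distrib, Finset.sum_const, Finset.card_univ,
    Fintype.card_fin, nsmul_eq_mul]
  have hn : (0 : ℝ) ≤ T * M := by positivity
  have hlow : K * (T * M : ℝ) / 4 ≤ K * (T * M) -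
      ∑ J, 𝔼 b, (∏ c : Fin T × Fin M, (1 + (ε : ℝ) * bitSign (b c.1 c.2 J))) * pulls a J b := by
    nlinarith [mul_le_mul_of_nonneg_left hεK hn, mul_le_mul_of_nonneg_left hK2 hn]
  calc K * ((ε : ℝ) * T / 8) = ε / (2 * M) * (K * (T * M : ℝ) / 4) := by field_simp; ring
    _ ≤ _ := mul_le_mul_of_nonneg_left hlow (div_nonneg ε.2.1 (by positivity))
    _ = _ := by rw [mul_left_comm (K : ℝ)]

/-- Some position of the biased arm is at least as bad as the average over all positions. The
position is chosen after averaging over graphs and seeds, so it depends on neither. -/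
lemma exists_le_expectedRegret {S : Type*} [MeasurableSpace S] (hM : 1 ≤ M) (hK : 2 ≤ K)
    (ε : unitInterval) (hε : (ε : ℝ) ≤ 1 / 2) (hεK : ε * √(K * (T * M)) ≤ (K : ℝ) / 8)
    (Q : Measure (Fin T → SimpleGraph (Fin M))) [IsProbabilityMeasure Q]
    (ρ : Measure S) [IsProbabilityMeasure ρ] (π : Policy M K T S) :
    ∃ ν : Instance M K, (ε : ℝ) * T / 8 ≤ expectedRegret ν Q ρ π := by
  have hi : ∀ J : Fin K, Integrable (fun y : (Fin T → SimpleGraph (Fin M)) × S =>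
      ∫ r, regret (bernoulliInstance M (biasedMean ε J)) (π.action y.1 y.2 r)
        ∂(bernoulliInstance M (biasedMean ε J)).rewardLaw T) (Q.prod ρ) := fun J =>
    (integrable_regret _ π _).integral_prod_left
  have hsum : K * ((ε : ℝ) * T / 8) ≤ ∑ J : Fin K,
      expectedRegret (bernoulliInstance M (biasedMean ε J)) Q ρ π := by
    simp only [expectedRegret]
    simp_rw [integral_prod _ (integrable_regret _ π _)]
    rw [← integral_finsetSum _ fun J _ => hi J]
    calc K * ((ε : ℝ) * T / 8) = ∫ _, K * ((ε : ℝ) * T / 8) ∂(Q.prod ρ) := by simp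
      _ ≤ _ := integral_mono (integrable_const _) (integrable_finsetSum _ fun J _ => hi J)
        fun y => le_sum_integral_regret hM hK ε hε hεK π y.1 y.2
  have : Nonempty (Fin K) := ⟨⟨0, by omega⟩⟩
  obtain ⟨J, -, hJ⟩ := Finset.exists_le_of_sum_le (s := Finset.univ) Finset.univ_nonempty
    (f := fun _ : Fin K => ((ε : ℝ) * T / 8)) (by simpa using hsum)
  exact ⟨_, hJ⟩

/-- The bias `ε = min (1/2) (√(K / (T M)) / 8)` is the largest, up to a constant, that the `T M`
pulls, spread over `K` arms, do not reveal. -/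
theorem exists_min_le_expectedRegret {S : Type*} [MeasurableSpace S] (hM : 1 ≤ M) (hK : 2 ≤ K)
    (Q : Measure (Fin T → SimpleGraph (Fin M))) [IsProbabilityMeasure Q]
    (ρ : Measure S) [IsProbabilityMeasure ρ] (π : Policy M K T S) :
    ∃ ν : Instance M K, 1 / 64 * min (T : ℝ) √((K : ℝ) * T / (1 + M)) ≤
      expectedRegret ν Q ρ π := by
  have hM0 : (0 : ℝ) < M := by positivity
  -- At `T = 0` the division by zero gives bias `0`, and both sides of the bound vanish.
  set x : ℝ := √(K / (T * M)) / 8 with hx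
  have hx0 : 0 ≤ x := by positivity
  have hmem : min (1 / 2) x ∈ unitInterval :=
    ⟨le_min (by norm_num) hx0, (min_le_left _ _).trans (by norm_num)⟩
  obtain ⟨ν, hν⟩ := exists_le_expectedRegret hM hK ⟨min (1 / 2) x, hmem⟩ (min_le_left _ _) (by
    calc min (1 / 2) x * √(K * (T * M)) ≤ x * √(K * (T * M)) := by
          gcongr
          exact min_le_right _ _
      _ = √(K / (T * M) * (K * (T * M))) / 8 := by
          rw [Real.sqrt_mul (x := K / (T * M)) (by positivity), hx]
          ring
      _ ≤ √((K : ℝ) ^ 2) / 8 := by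
          gcongr
          rcases eq_or_ne (T : ℝ) 0 with h | h
          · simp only [h, zero_mul, mul_zero]
            positivity
          · apply le_of_eq
            field_simp
      _ = K / 8 := by rw [Real.sqrt_sq (by positivity)]) Q ρ π
  refine ⟨ν, le_trans ?_ hν⟩
  have hxT : x * T = √(K * T / M) / 8 := by
    rcases eq_or_ne (T : ℝ) 0 with h | h
    · simp [h]
    · rw [hx, div_mul_eq_mul_div]
      congr 1
      rw [show (K : ℝ) * T / M = K / (T * M) * T ^ 2 by field_simp,
        Real.sqrt_mul (by positivity), Real.sqrt_sq (Nat.cast_nonneg T)]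
  have hmono : √((K : ℝ) * T / (1 + M)) ≤ √(K * T / M) := by
    gcongr
    linarith
  change 1 / 64 * min (T : ℝ) √((K : ℝ) * T / (1 + M)) ≤ min (1 / 2) x * T / 8
  have h1 := min_le_left (T : ℝ) √((K : ℝ) * T / (1 + M))
  have h2 := min_le_right (T : ℝ) √((K : ℝ) * T / (1 + M))
  have hT0 : (0 : ℝ) ≤ T := Nat.cast_nonneg T
  rcases min_cases (1 / 2) x with ⟨h, -⟩ | ⟨h, -⟩ <;> rw [h]
  · linarith
  · linarith

lemma sqrt_le_min (hK : 2 ≤ K) :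
    √(1 / (1 + M : ℝ)) * √T ≤ min (T : ℝ) √((K : ℝ) * T / (1 + M)) := by
  have hK1 : (1 : ℝ) ≤ K := by exact_mod_cast (by omega : 1 ≤ K)
  rw [← Real.sqrt_mul (by positivity)]
  refine le_min (Real.sqrt_le_iff.2 ⟨Nat.cast_nonneg T, ?_⟩) (Real.sqrt_le_sqrt ?_)
  · have hTT : (T : ℝ) ≤ T ^ 2 := by exact_mod_cast Nat.le_self_pow two_ne_zero T
    have h1 : 1 / (1 + M : ℝ) ≤ 1 := by
      rw [div_le_one (by positivity)]
      linarith [(Nat.cast_nonneg M : (0 : ℝ) ≤ M)]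
    nlinarith [(Nat.cast_nonneg T : (0 : ℝ) ≤ T)]
  · rw [div_mul_eq_mul_div]
    gcongr

end Hard

end MultiAgentBandit

end

theorem theorem6 :
    (∃ c : ℝ, 0 < c ∧ ∀ (M K T : ℕ), 1 ≤ M → 2 ≤ K →
      ∀ Q : MeasureTheory.Measure (Fin T → SimpleGraph (Fin M)),
      MeasureTheory.IsProbabilityMeasure Q →
      (MultiAgentBandit.IsDeterministicModel Q ∨ MultiAgentBandit.IsErdosRenyiModel Q ∨
        MultiAgentBandit.IsRandomConnectedModel Q) →
      ∀ (S : Type*) [MeasurableSpace S] (ρ : MeasureTheory.Measure S)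
        [MeasureTheory.IsProbabilityMeasure ρ] (π : MultiAgentBandit.Policy M K T S),
      ∃ ν : MultiAgentBandit.Instance M K,
        c * min (T : ℝ) (Real.sqrt ((K : ℝ) * (T : ℝ) / (1 + (M : ℝ)))) ≤
          MultiAgentBandit.expectedRegret ν Q ρ π) ∧
    (∀ M : ℕ, 1 ≤ M → ∃ c : ℝ, 0 < c ∧ ∀ (K T : ℕ), 2 ≤ K →
      ∀ Q : MeasureTheory.Measure (Fin T → SimpleGraph (Fin M)),
      MeasureTheory.IsProbabilityMeasure Q →
      (MultiAgentBandit.IsDeterministicModel Q ∨ MultiAgentBandit.IsErdosRenyiModel Q ∨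
        MultiAgentBandit.IsRandomConnectedModel Q) →
      ∀ (S : Type*) [MeasurableSpace S] (ρ : MeasureTheory.Measure S)
        [MeasureTheory.IsProbabilityMeasure ρ] (π : MultiAgentBandit.Policy M K T S),
      ∃ ν : MultiAgentBandit.Instance M K,
        c * Real.sqrt (T : ℝ) ≤ MultiAgentBandit.expectedRegret ν Q ρ π) := by
  refine ⟨⟨1 / 64, by norm_num, fun M K T hM hK Q hQ _ S _ ρ _ π =>
    MultiAgentBandit.exists_min_le_expectedRegret hM hK Q ρ π⟩, fun M hM =>
    ⟨1 / 64 * √(1 / (1 + M : ℝ)), by positivity, fun K T hK Q hQ _ S _ ρ _ π => ?_⟩⟩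
  obtain ⟨ν, hν⟩ := MultiAgentBandit.exists_min_le_expectedRegret hM hK Q ρ π
  refine ⟨ν, le_trans ?_ hν⟩
  rw [mul_assoc]
  exact mul_le_mul_of_nonneg_left (MultiAgentBandit.sqrt_le_min hK) (by norm_num)
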